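/- Let $\mathcal H$ be a complex Hilbert space, let $X$ be a bounded linear operator on $\mathcal H$, and let $\rho\in(0,2]$ and $\nu\in[0,1]$. Put $\alpha=\sqrt{8\rho^{-1}-4}$ and $\beta=2\rho^{-1}-2$, write $|T|=(T^*T)^{1/2}$, let $\|\cdot\|$ be the operator norm, and let $w(T)=\sup_{\|z\|=1}|\langle Tz,z\rangle|$ be the numerical radius. An operator $T$ on $\mathcal H$ is called a $\rho$-contraction if there are a Hilbert space $\mathcal K\supseteq\mathcal H$ and a unitary operator $U$ on $\mathcal K$ such that $T^nx=\rho PU^nx$ for all $x\in\mathcal H$ and all $n\ge 1$, where $P$ is the orthogonal projection of $\mathcal K$ onto $\mathcal H$; let $$w_\rho(X)=\inf\{t>0:\ t^{-1}X\text{ is a }\rho\text{-contraction}\}.$$ Define, with operator matrices acting on the Hilbert space direct sum $\mathcal H\oplus\mathcal H$, $$\Delta_{(\rho,\nu)}(X)=w\left(\begin{bmatrix}0&\alpha X\\ \alpha(1-2\nu)X^*&\beta\left(X+(1-2\nu)X^*\right)\end{bmatrix}\right).$$ Then $$\Delta_{(\rho,\nu)}^2(X)\le(1-2\nu)^2\,w_\rho^2(X)+\frac{2|1-2\nu|+1}{2}\left\|\begin{bmatrix}\mathbf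 A&\mathbf B\\ \mathbf B&\mathbf C\end{bmatrix}\right\|,$$ where $\mathbf A=\alpha^2|X^*|^2$, $\mathbf B=\alpha\beta|X^*|^2$ and $\mathbf C=(\alpha^2+\beta^2)|X|^2+\beta^2|X^*|^2$. -/

import Mathlib

open scoped InnerProductSpace

universe u

namespace OperatorRadius

noncomputable section

/-- The numerical radius `w(X) = sup {|⟨Xz, z⟩| : ‖z‖ = 1}` of a bounded operator. -/
def numRadius {H : Type u} [NormedAddCommGroup H] [InnerProductSpace ℂ H]
    (X : H →L[ℂ] H) : ℝ :=
  sSup {r : ℝ | ∃ z : H, ‖z‖ = 1 ∧ r = ‖⟪X z, z⟫_ℂ‖}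

/-- The set over which the numerical radius is taken is bounded, so the supremum is genuine. -/
theorem numRadius_bddAbove {H : Type u} [NormedAddCommGroup H] [InnerProductSpace ℂ H]
    (X : H →L[ℂ] H) : BddAbove {r : ℝ | ∃ z : H, ‖z‖ = 1 ∧ r = ‖⟪X z, z⟫_ℂ‖} := by
  refine ⟨‖X‖, ?_⟩
  rintro r ⟨z, hz, rfl⟩
  have h1 := norm_inner_le_norm (𝕜 := ℂ) (X z) z
  have h2 := X.le_opNorm z
  rw [hz, mul_one] at h1 h2
  exact h1.trans h2

/-- `X` is a `ρ`-contraction: it has a unitary `ρ`-dilation, that is, `H` embeds isometrically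
(through `V`) in a Hilbert space `K` carrying a unitary operator `U` such that
`X ^ n x = ρ P U ^ n x` for all `x` in `H` and all `n ≥ 1`. The orthogonal projection `P` of `K`
onto `H`, read as a map `K → H`, is the adjoint of the embedding `V`.
(Taking `K` in the universe of `H` loses nothing: the closed span of all `U ^ n (V x)`, `n` an
integer, reduces `U` and is a completion of a quotient of the finitely supported functions
from the integers to `H`.) -/
def IsRhoContraction {H : Type u} [NormedAddCommGroup H] [InnerProductSpace ℂ H]
    [CompleteSpace H] (ρ : ℝ) (X : H →L[ℂ] H) : Prop :=
  ∃ (K : Type u) (_ : NormedAddCommGroup K) (_ : InnerProductSpace ℂ K) (_ : CompleteSpace K)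
    (V : H →ₗᵢ[ℂ] K) (U : K →L[ℂ] K),
    U ∈ unitary (K →L[ℂ] K) ∧
    ∀ n : ℕ, 1 ≤ n → ∀ x : H,
      (X ^ n) x = (ρ : ℂ) • V.toContinuousLinearMap.adjoint ((U ^ n) (V x))

/-- The operator radius `w_ρ(X) = inf {t > 0 : t⁻¹ X is a ρ-contraction}`. -/
def rhoRadius {H : Type u} [NormedAddCommGroup H] [InnerProductSpace ℂ H]
    [CompleteSpace H] (ρ : ℝ) (X : H →L[ℂ] H) : ℝ :=
  sInf {t : ℝ | 0 < t ∧ IsRhoContraction ρ (((t⁻¹ : ℝ) : ℂ) • X)}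

/-- The operator matrix `[[S, X], [Y, T]]` on the Hilbert space direct sum `H ⊕ H`. -/
def blockOp {H : Type u} [NormedAddCommGroup H] [InnerProductSpace ℂ H]
    (S X Y T : H →L[ℂ] H) : WithLp 2 (H × H) →L[ℂ] WithLp 2 (H × H) :=
  ((WithLp.prodContinuousLinearEquiv 2 ℂ H H).symm : (H × H) →L[ℂ] WithLp 2 (H × H)) ∘L
    ((S.coprod X).prod (Y.coprod T)) ∘L
      (WithLp.prodContinuousLinearEquiv 2 ℂ H H : WithLp 2 (H × H) →L[ℂ] (H × H))

/-- `α = √(8 ρ⁻¹ - 4)`. -/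
def coeffAlpha (ρ : ℝ) : ℝ := Real.sqrt (8 * ρ⁻¹ - 4)

/-- `β = 2 ρ⁻¹ - 2`. -/
def coeffBeta (ρ : ℝ) : ℝ := 2 * ρ⁻¹ - 2

/-- `Δ_(ρ,ν)(X)`, the numerical radius of the operator matrix
`[[0, α X], [α (1 - 2ν) X*, β (X + (1 - 2ν) X*)]]`. -/
def Delta {H : Type u} [NormedAddCommGroup H] [InnerProductSpace ℂ H] [CompleteSpace H]
    (ρ ν : ℝ) (X : H →L[ℂ] H) : ℝ :=
  numRadius (blockOp
    0
    ((coeffAlpha ρ : ℂ) • X)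
    (((coeffAlpha ρ * (1 - 2 * ν) : ℝ) : ℂ) • X.adjoint)
    ((coeffBeta ρ : ℂ) • (X + ((1 - 2 * ν : ℝ) : ℂ) • X.adjoint)))

end

end OperatorRadius

/-! With N = [[0, αX], [0, βX]] and k = 1 - 2ν, the matrix defining `Delta` is N + kN*. For a unit
vector z, |⟨(N + kN*)z, z⟩| ≤ (1 + |k|)|⟨Nz, z⟩|. Square this and split (1 + |k|)² = k² + (2|k| +
1). The k² share is bounded by w(N) ≤ w_ρ(X), the rest by |⟨Nz, z⟩|² ≤ ‖NN* + N*N‖/2; the block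
matrix of the statement is NN* + N*N.

The substance is w(N) ≤ w_ρ(X). The unitary dilation of a ρ-contraction T gives 1 + β Re T - (α²/4)
T*T ≥ 0. Completing a square turns this into a bound on the form of [[0, αT], [0, βT]], and rotating
T by phases bounds its modulus. Passing to the infimum requires some multiple of X to be a
ρ-contraction, which is why a dilation is constructed. -/

namespace OperatorRadius

/-! ### Unitary dilation of strict contractions -/

section Dilation

variable {E : Type u} [NormedAddCommGroup E] [InnerProductSpace ℂ E]

/-- The bilateral shift `(f k) ↦ (f (k + 1))` on `ℓ²(ℤ, E)`. -/
noncomputable def bilateralShift (E : Type u) [NormedAddCommGroup E] [InnerProductSpace ℂ E] :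
    lp (fun _ : ℤ => E) 2 ≃ₗᵢ[ℂ] lp (fun _ : ℤ => E) 2 :=
  have mem (m : ℤ) (f : lp (fun _ : ℤ => E) 2) :
      Memℓp (fun k : ℤ => f (k + m)) 2 := by
    apply memℓp_gen
    exact ((memℓp_gen_iff (by norm_num)).1 (lp.memℓp f)).comp_injective (add_left_injective m)
  { toFun := fun f => ⟨fun k => f (k + 1), mem 1 f⟩
    invFun := fun f => ⟨fun k => f (k + -1), mem (-1) f⟩
    map_add' := fun f g => by ext k; rfl
    map_smul' := fun c f => by ext k; rfl
    left_inv := fun f => by ext k; simp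
    right_inv := fun f => by ext k; simp
    norm_map' := fun f => by
      rw [lp.norm_eq_tsum_rpow (by norm_num), lp.norm_eq_tsum_rpow (by norm_num)]
      congr 1
      exact (Equiv.addRight (1 : ℤ)).tsum_eq (fun k => ‖f k‖ ^ (2 : ENNReal).toReal) }

theorem bilateralShift_apply (f : lp (fun _ : ℤ => E) 2) (k : ℤ) :
    bilateralShift E f k = f (k + 1) := rfl

/-- The bilateral shift as a bounded operator. -/
noncomputable def bilateralShiftCLM (E : Type u) [NormedAddCommGroup E] [InnerProductSpace ℂ E] :
    lp (fun _ : ℤ => E) 2 →L[ℂ] lp (fun _ : ℤ => E) 2 :=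
  (bilateralShift E).toContinuousLinearEquiv.toContinuousLinearMap

theorem bilateralShiftCLM_pow_apply (n : ℕ) (f : lp (fun _ : ℤ => E) 2) (k : ℤ) :
    ((bilateralShiftCLM E ^ n) f) k = f (k + n) := by
  induction n generalizing k with
  | zero => simp
  | succ n ih =>
    rw [pow_succ', mul_apply_eq_comp]
    refine (bilateralShift_apply _ k).trans ?_
    rw [ih]
    rw [show k + 1 + (n : ℤ) = k + ((n + 1 : ℕ) : ℤ) by push_cast; ring]

theorem linearIsometryEquiv_mem_unitary {K : Type u} [NormedAddCommGroup K]
    [InnerProductSpace ℂ K] [CompleteSpace K] (e : K ≃ₗᵢ[ℂ] K) :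
    ((e : K ≃L[ℂ] K) : K →L[ℂ] K) ∈ unitary (K →L[ℂ] K) :=
  (Unitary.linearIsometryEquiv.symm e).2

/-- The orbit `(D S ^ k x)` of `x`, extended by zero to negative indices. -/
def orbitFun (S D : E →L[ℂ] E) (x : E) : ℤ → E
  | .ofNat n => D ((S ^ n) x)
  | .negSucc _ => 0

theorem orbitFun_eq_zero (S D : E →L[ℂ] E) (x : E) (k : ℤ)
    (hk : k ∉ Set.range ((↑) : ℕ → ℤ)) : orbitFun S D x k = 0 := by
  cases k with
  | ofNat n => exact absurd ⟨n, rfl⟩ hk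
  | negSucc n => rfl

theorem orbitFun_natCast (S D : E →L[ℂ] E) (x : E) (k : ℕ) :
    orbitFun S D x (k : ℤ) = D ((S ^ k) x) := rfl

theorem orbitFun_add (S D : E →L[ℂ] E) (x y : E) (k : ℤ) :
    orbitFun S D (x + y) k = orbitFun S D x k + orbitFun S D y k := by
  cases k <;> simp [orbitFun]

theorem orbitFun_smul (S D : E →L[ℂ] E) (c : ℂ) (x : E) (k : ℤ) :
    orbitFun S D (c • x) k = c • orbitFun S D x k := by
  cases k <;> simp [orbitFun]

/-- The defect operator of a contraction. -/
theorem exists_defect [CompleteSpace E] (S : E →L[ℂ] E) (hS : ‖S‖ ≤ 1) :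
    ∃ D : E →L[ℂ] E, ∀ x y : E, ⟪D x, D y⟫_ℂ = ⟪x, y⟫_ℂ - ⟪S x, S y⟫_ℂ := by
  have h1 : star S * S ≤ 1 := by
    rw [← CStarAlgebra.norm_le_one_iff_of_nonneg (star S * S) (star_mul_self_nonneg S),
      CStarRing.norm_star_mul_self]
    exact mul_le_one₀ hS (norm_nonneg _) hS
  refine ⟨CFC.sqrt (1 - star S * S), fun x y => ?_⟩
  have h2 := CFC.sqrt_mul_sqrt_self (1 - star S * S) (sub_nonneg.2 h1)
  have h3 : star (CFC.sqrt (1 - star S * S)) = CFC.sqrt (1 - star S * S) :=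
    (CFC.sqrt_nonneg _).star_eq
  rw [ContinuousLinearMap.star_eq_adjoint] at h3
  rw [← ContinuousLinearMap.adjoint_inner_right, h3, ← mul_apply_eq_comp, h2,
    sub_apply, inner_sub_right, mul_apply_eq_comp,
    ContinuousLinearMap.star_eq_adjoint, ContinuousLinearMap.adjoint_inner_right]
  rfl

theorem norm_pow_apply_tendsto_zero (S : E →L[ℂ] E) (hS : ‖S‖ < 1) (x : E) :
    Filter.Tendsto (fun n : ℕ => (S ^ n) x) Filter.atTop (nhds 0) := by
  have h := tendsto_pow_atTop_nhds_zero_of_norm_lt_one hS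
  have h' := ((ContinuousLinearMap.apply ℂ E x).continuous.tendsto 0).comp h
  rw [map_zero] at h'
  exact h'

/-- The sum of ‖D Sⁱ x‖² = ‖Sⁱ x‖² - ‖Sⁱ⁺¹ x‖² telescopes and stays below ‖x‖². -/
theorem memℓp_orbitFun (S D : E →L[ℂ] E)
    (hD : ∀ x y : E, ⟪D x, D y⟫_ℂ = ⟪x, y⟫_ℂ - ⟪S x, S y⟫_ℂ) (x : E) :
    Memℓp (orbitFun S D x) 2 := by
  apply memℓp_gen
  have hinj : Function.Injective ((↑) : ℕ → ℤ) := Nat.cast_injective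
  rw [← hinj.summable_iff]
  · have hn (y : E) : ‖D y‖ ^ 2 = ‖y‖ ^ 2 - ‖S y‖ ^ 2 := by
      have := congrArg Complex.re (hD y y)
      simpa [inner_self_eq_norm_sq_to_K, ← Complex.ofReal_pow] using this
    refine summable_of_sum_range_le (c := ‖x‖ ^ 2)
      (fun n => Real.rpow_nonneg (norm_nonneg _) _) (fun n => ?_)
    have hsum : ∀ m : ℕ, ∑ i ∈ Finset.range m, ‖D ((S ^ i) x)‖ ^ 2 =
        ‖x‖ ^ 2 - ‖(S ^ m) x‖ ^ 2 := by
      intro m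
      induction m with
      | zero => simp
      | succ m ih => rw [Finset.sum_range_succ, ih, hn, pow_succ' S m]; simp
    have := hsum n
    simp only [Function.comp_apply, orbitFun_natCast, ENNReal.toReal_ofNat, Real.rpow_ofNat]
    rw [this]
    linarith [sq_nonneg ‖(S ^ n) x‖]
  · intro k hk
    simp [orbitFun_eq_zero S D x k hk]

/-- The defect identity makes the partial sums telescope; the remainder vanishes because Sᵐ → 0,
which is where strictness enters. -/
theorem tsum_inner_orbitFun (S D : E →L[ℂ] E) (hS : ‖S‖ < 1)
    (hD : ∀ x y : E, ⟪D x, D y⟫_ℂ = ⟪x, y⟫_ℂ - ⟪S x, S y⟫_ℂ) (x y : E) (n : ℕ) {s : ℂ}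
    (hs : HasSum (fun k : ℤ => ⟪orbitFun S D x k, orbitFun S D y (k + n)⟫_ℂ) s) :
    s = ⟪x, (S ^ n) y⟫_ℂ := by
  have hinj : Function.Injective ((↑) : ℕ → ℤ) := Nat.cast_injective
  rw [← hinj.hasSum_iff (fun k hk => by simp [orbitFun_eq_zero S D x k hk])] at hs
  refine tendsto_nhds_unique hs.tendsto_sum_nat ?_
  have hsum : ∀ m : ℕ, ∑ i ∈ Finset.range m, ((fun k : ℤ =>
      ⟪orbitFun S D x k, orbitFun S D y (k + n)⟫_ℂ) ∘ ((↑) : ℕ → ℤ)) i =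
        ⟪x, (S ^ n) y⟫_ℂ - ⟪(S ^ m) x, (S ^ m) ((S ^ n) y)⟫_ℂ := by
    intro m
    induction m with
    | zero => simp
    | succ m ih =>
      rw [Finset.sum_range_succ, ih]
      simp only [Function.comp_apply]
      rw [← Nat.cast_add, orbitFun_natCast, orbitFun_natCast, hD, pow_add, pow_succ' S m]
      simp
  simp_rw [hsum]
  have := ((norm_pow_apply_tendsto_zero S hS x).inner (𝕜 := ℂ)
    (norm_pow_apply_tendsto_zero S hS ((S ^ n) y))).const_sub ⟪x, (S ^ n) y⟫_ℂ
  simpa using this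

/-- **Sz.-Nagy dilation** of a strict contraction. -/
theorem exists_unitary_dilation [CompleteSpace E] (S : E →L[ℂ] E) (hS : ‖S‖ < 1) :
    ∃ (K : Type u) (_ : NormedAddCommGroup K) (_ : InnerProductSpace ℂ K) (_ : CompleteSpace K)
      (V : E →ₗᵢ[ℂ] K) (U : K →L[ℂ] K), U ∈ unitary (K →L[ℂ] K) ∧
      ∀ (n : ℕ) (x y : E), ⟪V x, (U ^ n) (V y)⟫_ℂ = ⟪x, (S ^ n) y⟫_ℂ := by
  obtain ⟨D, hD⟩ := exists_defect S hS.le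
  let V₀ : E →ₗ[ℂ] lp (fun _ : ℤ => E) 2 :=
    { toFun := fun x => ⟨orbitFun S D x, memℓp_orbitFun S D hD x⟩
      map_add' := fun x y => lp.ext (funext (orbitFun_add S D x y))
      map_smul' := fun c x => lp.ext (funext (orbitFun_smul S D c x)) }
  have key (n : ℕ) (x y : E) :
      ⟪V₀ x, (bilateralShiftCLM E ^ n) (V₀ y)⟫_ℂ = ⟪x, (S ^ n) y⟫_ℂ := by
    apply tsum_inner_orbitFun S D hS hD
    have h := lp.hasSum_inner (𝕜 := ℂ) (V₀ x) ((bilateralShiftCLM E ^ n) (V₀ y))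
    simp_rw [bilateralShiftCLM_pow_apply] at h
    exact h
  refine ⟨lp (fun _ : ℤ => E) 2, inferInstance, inferInstance, inferInstance,
    V₀.isometryOfInner fun x y => ?_, _, linearIsometryEquiv_mem_unitary (bilateralShift E), key⟩
  simpa using key 0 x y

end Dilation

end OperatorRadius

namespace OperatorRadius

/-! ### Existence of ρ-contractive multiples -/

section Block

variable {H : Type u} [NormedAddCommGroup H] [InnerProductSpace ℂ H]

theorem blockOp_fst (S X Y T : H →L[ℂ] H) (z : WithLp 2 (H × H)) :
    (blockOp S X Y T z).fst = S z.fst + X z.snd := rfl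

theorem blockOp_snd (S X Y T : H →L[ℂ] H) (z : WithLp 2 (H × H)) :
    (blockOp S X Y T z).snd = Y z.fst + T z.snd := rfl

theorem withLp_prod_ext {H : Type u} {z w : WithLp 2 (H × H)} (h₁ : z.fst = w.fst)
    (h₂ : z.snd = w.snd) :
    z = w :=
  (WithLp.equiv 2 (H × H)).injective (Prod.ext h₁ h₂)

/-- The isometric embedding of `H` as the first summand of `H ⊕ H`. -/
noncomputable def inlIsometry (H : Type u) [NormedAddCommGroup H] [InnerProductSpace ℂ H] :
    H →ₗᵢ[ℂ] WithLp 2 (H × H) where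
  toFun x := WithLp.toLp 2 (x, 0)
  map_add' x y := withLp_prod_ext rfl (by simp)
  map_smul' c x := withLp_prod_ext rfl (by simp)
  norm_map' x := by simp

theorem inlIsometry_fst (x : H) : (inlIsometry H x).fst = x := rfl

theorem inlIsometry_snd (x : H) : (inlIsometry H x).snd = 0 := rfl

/-- The tensor product of `T` with the idempotent matrix `[[c, c], [1 - c, 1 - c]]`. -/
noncomputable def idempotentBlock (c : ℂ) (T : H →L[ℂ] H) :
    WithLp 2 (H × H) →L[ℂ] WithLp 2 (H × H) :=
  blockOp (c • T) (c • T) ((1 - c) • T) ((1 - c) • T)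

theorem idempotentBlock_smul (a c : ℂ) (T : H →L[ℂ] H) :
    idempotentBlock c (a • T) = a • idempotentBlock c T := by
  ext z
  refine withLp_prod_ext ?_ ?_
  · simp only [idempotentBlock, blockOp_fst, smul_apply, WithLp.smul_fst]
    module
  · simp only [idempotentBlock, blockOp_snd, smul_apply, WithLp.smul_snd]
    module

theorem idempotentBlock_pow_succ_inl (c : ℂ) (T : H →L[ℂ] H) (n : ℕ) (x : H) :
    ((idempotentBlock c T ^ (n + 1)) (inlIsometry H x)).fst = c • (T ^ (n + 1)) x ∧
    ((idempotentBlock c T ^ (n + 1)) (inlIsometry H x)).snd = (1 - c) • (T ^ (n + 1)) x := by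
  induction n with
  | zero =>
    simp [idempotentBlock, blockOp_fst, blockOp_snd, inlIsometry_fst, inlIsometry_snd]
  | succ n ih =>
    rw [pow_succ' _ (n + 1), pow_succ' _ (n + 1), mul_apply_eq_comp, mul_apply_eq_comp]
    constructor
    · conv_lhs => rw [idempotentBlock, blockOp_fst, ← idempotentBlock, ih.1, ih.2]
      simp only [smul_apply, map_smul]
      module
    · conv_lhs => rw [idempotentBlock, blockOp_snd, ← idempotentBlock, ih.1, ih.2]
      simp only [smul_apply, map_smul]
      module

variable [CompleteSpace H]

/-- The matrix factor is idempotent with corner entry ρ⁻¹, so every positive power of the block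
compresses to ρ⁻¹Tⁿ on the first summand. Dilating the block therefore gives a ρ-dilation of T. -/
theorem isRhoContraction_of_norm_idempotentBlock_lt_one {ρ : ℝ} (hρ : 0 < ρ) (T : H →L[ℂ] H)
    (hT : ‖idempotentBlock ((ρ : ℂ)⁻¹) T‖ < 1) : IsRhoContraction ρ T := by
  obtain ⟨K, _, _, _, V, U, hU, hV⟩ := exists_unitary_dilation _ hT
  refine ⟨K, _, _, ‹_›, V.comp (inlIsometry H), U, hU, fun n hn x => ?_⟩
  obtain ⟨n, rfl⟩ := Nat.exists_eq_add_of_le' hn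
  refine ext_inner_left ℂ fun y => ?_
  rw [inner_smul_right, ContinuousLinearMap.adjoint_inner_right]
  change _ = _ * ⟪V (inlIsometry H y), (U ^ (n + 1)) (V (inlIsometry H x))⟫_ℂ
  rw [hV, WithLp.prod_inner_apply]
  change _ = _ * (⟪(inlIsometry H y).fst, WithLp.fst _⟫_ℂ + ⟪(inlIsometry H y).snd, WithLp.snd _⟫_ℂ)
  rw [inlIsometry_snd, inner_zero_left, add_zero, inlIsometry_fst,
    (idempotentBlock_pow_succ_inl _ _ _ _).1, inner_smul_right,
    mul_inv_cancel_left₀ (by exact_mod_cast hρ.ne')]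

/-- The infimum that defines `rhoRadius` is taken over a nonempty set. -/
theorem rhoRadius_set_nonempty {ρ : ℝ} (hρ : 0 < ρ) (X : H →L[ℂ] H) :
    {t : ℝ | 0 < t ∧ IsRhoContraction ρ (((t⁻¹ : ℝ) : ℂ) • X)}.Nonempty := by
  have h0 : 0 < ‖idempotentBlock ((ρ : ℂ)⁻¹) X‖ + 1 := by positivity
  refine ⟨‖idempotentBlock ((ρ : ℂ)⁻¹) X‖ + 1, h0,
    isRhoContraction_of_norm_idempotentBlock_lt_one hρ _ ?_⟩
  rw [idempotentBlock_smul, norm_smul, Complex.norm_real, Real.norm_of_nonneg (by positivity),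
    inv_mul_lt_one₀ h0]
  linarith

end Block

/-! ### Positivity forced by a ρ-dilation -/

section Contraction

variable {H : Type u} [NormedAddCommGroup H] [InnerProductSpace ℂ H] [CompleteSpace H]

theorem isRhoContraction_smul {ρ : ℝ} {T : H →L[ℂ] H} (hT : IsRhoContraction ρ T) {w : ℂ}
    (hw : ‖w‖ = 1) : IsRhoContraction ρ (w • T) := by
  obtain ⟨K, _, _, _, V, U, hU, hV⟩ := hT
  refine ⟨K, _, _, ‹_›, V, w • U, ?_, fun n hn x => ?_⟩
  · have h : star w * w = 1 := by
      rw [← starRingEnd_apply, Complex.conj_mul', hw]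
      simp
    rw [Unitary.mem_iff] at hU ⊢
    rw [star_smul, smul_mul_smul_comm, smul_mul_smul_comm, hU.1, hU.2, mul_comm w, h, one_smul]
    exact ⟨rfl, rfl⟩
  · rw [smul_pow, smul_pow, smul_apply, smul_apply, map_smul, hV n hn, smul_comm]

/-- The real part of `(1 - rU)⁻¹ - 1/2`, compressed to `H`, is positive. -/
theorem IsRhoContraction.norm_sq_add_nonneg {ρ : ℝ} (hρ : 0 < ρ) {T : H →L[ℂ] H}
    (hT : IsRhoContraction ρ T) {r : ℝ} (hr : 0 ≤ r) (hr1 : r < 1) (x : H) :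
    0 ≤ ‖x - (r : ℂ) • T x‖ ^ 2 +
      2 * (r * ρ⁻¹) * (⟪T x, x - (r : ℂ) • T x⟫_ℂ).re := by
  obtain ⟨K, _, _, _, V, U, hU, hV⟩ := hT
  set v := x - (r : ℂ) • T x with hv
  have hUn (k : K) : ‖U k‖ = ‖k‖ := U.norm_map_of_mem_unitary hU k
  have hUpow (n : ℕ) (k : K) : ‖(U ^ n) k‖ = ‖k‖ := by
    induction n with
    | zero => simp
    | succ n ih => rw [pow_succ', mul_apply_eq_comp, hUn, ih]
  have hr0 : Filter.Tendsto (fun n : ℕ => r ^ n) Filter.atTop (nhds 0) :=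
    tendsto_pow_atTop_nhds_zero_of_lt_one hr hr1
  -- Neumann series: its sum y is (1 - rU)⁻¹ V v.
  have hsummable : Summable fun n : ℕ => ((r ^ n : ℝ) : ℂ) • (U ^ n) (V v) := by
    refine Summable.of_norm_bounded (g := fun n => r ^ n * ‖v‖)
      ((summable_geometric_of_lt_one hr hr1).mul_right _) fun n => ?_
    rw [norm_smul, hUpow, V.norm_map, Complex.norm_real, Real.norm_of_nonneg (by positivity)]
  obtain ⟨y, hy⟩ := hsummable
  have hy1 : y - (r : ℂ) • U y = V v := by
    have h1 := hy.tendsto_sum_nat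
    have h2 := h1.sub (((U.continuous.tendsto y).comp h1).const_smul (r : ℂ))
    refine tendsto_nhds_unique h2 ?_
    have h3 : ∀ n : ℕ, (∑ i ∈ Finset.range n, ((r ^ i : ℝ) : ℂ) • (U ^ i) (V v)) -
        (r : ℂ) • U (∑ i ∈ Finset.range n, ((r ^ i : ℝ) : ℂ) • (U ^ i) (V v)) =
        V v - ((r ^ n : ℝ) : ℂ) • (U ^ n) (V v) := by
      intro n
      induction n with
      | zero => simp
      | succ n ih =>
        rw [Finset.sum_range_succ, map_add, map_smul, smul_add, add_sub_add_comm, ih,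
          pow_succ' U n, mul_apply_eq_comp]
        push_cast
        module
    have h4 : Filter.Tendsto (fun n : ℕ => V v - ((r ^ n : ℝ) : ℂ) • (U ^ n) (V v))
        Filter.atTop (nhds (V v - 0)) := by
      refine tendsto_const_nhds.sub (squeeze_zero_norm (a := fun n => r ^ n * ‖v‖) (fun n => ?_) ?_)
      · rw [norm_smul, hUpow, V.norm_map, Complex.norm_real, Real.norm_of_nonneg (by positivity)]
      · simpa using hr0.mul_const ‖v‖
    rw [sub_zero] at h4
    exact h4.congr fun n => (h3 n).symm
  -- Compression gives v from the term n = 0 and ρ⁻¹ rⁿ Tⁿ v from the others; since v = (1 - rT)x,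
  -- the latter telescope.
  have hy2 : V.toContinuousLinearMap.adjoint y = v + ((r * ρ⁻¹ : ℝ) : ℂ) • T x := by
    have h1 := ((V.toContinuousLinearMap.adjoint.continuous.tendsto y).comp
      hy.tendsto_sum_nat).comp (Filter.tendsto_add_atTop_nat 1)
    refine tendsto_nhds_unique h1 ?_
    have hVV : V.toContinuousLinearMap.adjoint (V v) = v := by
      refine ext_inner_left ℂ fun u => ?_
      rw [ContinuousLinearMap.adjoint_inner_right]
      exact V.inner_map_map u v
    have hpow (n : ℕ) : V.toContinuousLinearMap.adjoint ((U ^ (n + 1)) (V v)) =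
        ((ρ⁻¹ : ℝ) : ℂ) • (T ^ (n + 1)) v := by
      rw [hV (n + 1) (by omega), smul_smul, ← Complex.ofReal_mul, inv_mul_cancel₀ hρ.ne']
      simp
    have h3 : ∀ n : ℕ, V.toContinuousLinearMap.adjoint
        (∑ i ∈ Finset.range (n + 1), ((r ^ i : ℝ) : ℂ) • (U ^ i) (V v)) =
        v + ((r * ρ⁻¹ : ℝ) : ℂ) • T x -
          ((r ^ (n + 1) : ℝ) : ℂ) • ((ρ⁻¹ : ℝ) : ℂ) • (T ^ (n + 1)) x := by
      intro n
      induction n with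
      | zero =>
        simp only [zero_add, Finset.sum_range_one, pow_zero, Complex.ofReal_one, one_smul,
          one_apply_eq_self, hVV, pow_one]
        push_cast
        module
      | succ n ih =>
        rw [Finset.sum_range_succ, map_add, map_smul, ih, hpow, hv, map_sub, map_smul,
          ← mul_apply_eq_comp, ← pow_succ]
        push_cast
        module
    have hTpow (n : ℕ) : ‖((ρ⁻¹ : ℝ) : ℂ) • (T ^ (n + 1)) x‖ ≤
        ‖V.toContinuousLinearMap.adjoint‖ * ‖x‖ := by
      rw [hV (n + 1) (by omega), smul_smul, ← Complex.ofReal_mul, inv_mul_cancel₀ hρ.ne']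
      rw [Complex.ofReal_one, one_smul]
      refine (ContinuousLinearMap.le_opNorm _ _).trans_eq ?_
      rw [hUpow, V.norm_map]
    have h4 : Filter.Tendsto (fun n : ℕ => v + ((r * ρ⁻¹ : ℝ) : ℂ) • T x -
          ((r ^ (n + 1) : ℝ) : ℂ) • ((ρ⁻¹ : ℝ) : ℂ) • (T ^ (n + 1)) x)
        Filter.atTop (nhds (v + ((r * ρ⁻¹ : ℝ) : ℂ) • T x - 0)) := by
      refine tendsto_const_nhds.sub (squeeze_zero_norm
        (a := fun n => r ^ (n + 1) * (‖V.toContinuousLinearMap.adjoint‖ * ‖x‖)) (fun n => ?_) ?_)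
      · rw [norm_smul, Complex.norm_real, Real.norm_of_nonneg (by positivity)]
        exact mul_le_mul_of_nonneg_left (hTpow n) (by positivity)
      · simpa using ((Filter.tendsto_add_atTop_iff_nat 1).2 hr0).mul_const
          (‖V.toContinuousLinearMap.adjoint‖ * ‖x‖)
    rw [sub_zero] at h4
    exact h4.congr fun n => (h3 n).symm
  -- Expand ‖y - V v‖² = ‖rUy‖² ≤ ‖y‖².
  have hpos : ‖v‖ ^ 2 ≤ 2 * (⟪y, V v⟫_ℂ).re := by
    have h1 : ‖(r : ℂ) • U y‖ ≤ ‖y‖ := by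
      rw [norm_smul, hUn, Complex.norm_real, Real.norm_of_nonneg hr]
      exact mul_le_of_le_one_left (norm_nonneg _) hr1.le
    have h2 : (r : ℂ) • U y = y - V v := by rw [← hy1]; abel
    have h3 := norm_sub_sq (𝕜 := ℂ) y (V v)
    rw [V.norm_map, ← h2] at h3
    have h4 := pow_le_pow_left₀ (norm_nonneg _) h1 2
    simp only [RCLike.re_to_complex] at h3
    linarith
  have h5 : ⟪y, V v⟫_ℂ = ⟪v + ((r * ρ⁻¹ : ℝ) : ℂ) • T x, v⟫_ℂ := by
    rw [← hy2, ContinuousLinearMap.adjoint_inner_left]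
    rfl
  have h6 : (⟪v, v⟫_ℂ).re = ‖v‖ ^ 2 := inner_self_eq_norm_sq (𝕜 := ℂ) v
  rw [h5, inner_add_left, inner_smul_left, Complex.conj_ofReal, Complex.add_re,
    Complex.re_ofReal_mul, h6] at hpos
  linarith

/-- A `ρ`-contraction satisfies `1 + β Re T - (2/ρ - 1) T*T ≥ 0`. -/
theorem IsRhoContraction.quadratic_nonneg {ρ : ℝ} (hρ : 0 < ρ) {T : H →L[ℂ] H}
    (hT : IsRhoContraction ρ T) (x : H) :
    0 ≤ ‖x‖ ^ 2 + coeffBeta ρ * (⟪T x, x⟫_ℂ).re - (2 * ρ⁻¹ - 1) * ‖T x‖ ^ 2 := by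
  have h (r : ℝ) (hr : r ∈ Set.Ico (0 : ℝ) 1) :
      0 ≤ ‖x‖ ^ 2 + r * coeffBeta ρ * (⟪T x, x⟫_ℂ).re
        - r ^ 2 * (2 * ρ⁻¹ - 1) * ‖T x‖ ^ 2 := by
    have h1 := hT.norm_sq_add_nonneg hρ hr.1 hr.2 x
    have h2 := norm_sub_sq (𝕜 := ℂ) x ((r : ℂ) • T x)
    have h3 : (⟪T x, T x⟫_ℂ).re = ‖T x‖ ^ 2 := inner_self_eq_norm_sq (𝕜 := ℂ) (T x)
    have h4 : (⟪x, T x⟫_ℂ).re = (⟪T x, x⟫_ℂ).re := inner_re_symm (𝕜 := ℂ) x (T x)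
    rw [inner_smul_right, norm_smul, Complex.norm_real, Real.norm_of_nonneg hr.1] at h2
    simp only [RCLike.re_to_complex, Complex.re_ofReal_mul] at h2
    rw [inner_sub_right, inner_smul_right, Complex.sub_re, Complex.re_ofReal_mul, h3, h2, h4] at h1
    rw [coeffBeta]
    linarith
  -- Let r increase to 1.
  have hc : Filter.Tendsto (fun r : ℝ => ‖x‖ ^ 2 + r * coeffBeta ρ * (⟪T x, x⟫_ℂ).re
        - r ^ 2 * (2 * ρ⁻¹ - 1) * ‖T x‖ ^ 2) (nhdsWithin 1 (Set.Iio 1))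
      (nhds (‖x‖ ^ 2 + 1 * coeffBeta ρ * (⟪T x, x⟫_ℂ).re
        - 1 ^ 2 * (2 * ρ⁻¹ - 1) * ‖T x‖ ^ 2)) :=
    Filter.Tendsto.mono_left (Continuous.tendsto (by fun_prop) 1) nhdsWithin_le_nhds
  have := ge_of_tendsto hc (Filter.mem_of_superset
    (Ico_mem_nhdsLT (show (0 : ℝ) < 1 by norm_num)) h)
  simpa using this

end Contraction

end OperatorRadius

namespace OperatorRadius

/-! ### Comparison of the column block with the ρ-radius -/

variable {H : Type u} [NormedAddCommGroup H] [InnerProductSpace ℂ H]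

theorem coeffAlpha_sq {ρ : ℝ} (hρ : ρ ∈ Set.Ioc (0 : ℝ) 2) : coeffAlpha ρ ^ 2 = 8 * ρ⁻¹ - 4 := by
  have h : 2⁻¹ ≤ ρ⁻¹ := inv_anti₀ hρ.1 hρ.2
  exact Real.sq_sqrt (by linarith)

theorem IsRhoContraction.norm_form_le [CompleteSpace H] {ρ : ℝ} (hρ : ρ ∈ Set.Ioc (0 : ℝ) 2)
    {T : H →L[ℂ] H}
    (hT : IsRhoContraction ρ T) (u v : H) :
    ‖(coeffAlpha ρ : ℂ) * ⟪T v, u⟫_ℂ + (coeffBeta ρ : ℂ) * ⟪T v, v⟫_ℂ‖ ≤ ‖u‖ ^ 2 + ‖v‖ ^ 2 := by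
  have key {S : H →L[ℂ] H} (hS : IsRhoContraction ρ S) :
      0 ≤ ‖u‖ ^ 2 + ‖v‖ ^ 2 +
        ((coeffAlpha ρ : ℂ) * ⟪S v, u⟫_ℂ + (coeffBeta ρ : ℂ) * ⟪S v, v⟫_ℂ).re := by
    have h1 := hS.quadratic_nonneg hρ.1 v
    have h2 := norm_add_sq (𝕜 := ℂ) (((coeffAlpha ρ / 2 : ℝ) : ℂ) • S v) u
    -- Here (α/2)² = 2ρ⁻¹ - 1 is exactly the coefficient of ‖Sv‖² in `quadratic_nonneg`.
    rw [inner_smul_left, norm_smul, Complex.norm_real, mul_pow, Real.norm_eq_abs, sq_abs,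
      div_pow, coeffAlpha_sq hρ, Complex.conj_ofReal] at h2
    simp only [RCLike.re_to_complex, Complex.re_ofReal_mul] at h2
    have h3 := sq_nonneg ‖((coeffAlpha ρ / 2 : ℝ) : ℂ) • S v + u‖
    rw [Complex.add_re, Complex.re_ofReal_mul, Complex.re_ofReal_mul]
    linarith
  set c := (coeffAlpha ρ : ℂ) * ⟪T v, u⟫_ℂ + (coeffBeta ρ : ℂ) * ⟪T v, v⟫_ℂ with hc
  rcases eq_or_ne c 0 with h0 | h0
  · rw [h0, norm_zero]
    positivity
  have hn : (‖c‖ : ℂ) ≠ 0 := by simpa using h0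
  -- The inner product conjugates its first argument, so this phase on T turns c into -‖c‖.
  have hw : ‖-(c / (‖c‖ : ℂ))‖ = 1 := by
    rw [norm_neg, norm_div, Complex.norm_real, norm_norm, div_self (norm_ne_zero_iff.2 h0)]
  have h1 := key (isRhoContraction_smul hT hw)
  have h2 : (coeffAlpha ρ : ℂ) * ⟪((-(c / (‖c‖ : ℂ))) • T) v, u⟫_ℂ +
      (coeffBeta ρ : ℂ) * ⟪((-(c / (‖c‖ : ℂ))) • T) v, v⟫_ℂ = ((-‖c‖ : ℝ) : ℂ) := by
    rw [smul_apply, inner_smul_left, inner_smul_left, mul_left_comm,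
      mul_left_comm (coeffBeta ρ : ℂ), ← mul_add, ← hc, map_neg, map_div₀, Complex.conj_ofReal,
      neg_mul, div_mul_eq_mul_div, Complex.conj_mul', sq, mul_div_assoc, div_self hn]
    simp
  rw [h2, Complex.ofReal_re] at h1
  linarith

/-- The operator matrix `[[0, α X], [0, β X]]`. -/
noncomputable def columnBlock (ρ : ℝ) (X : H →L[ℂ] H) :
    WithLp 2 (H × H) →L[ℂ] WithLp 2 (H × H) :=
  blockOp 0 ((coeffAlpha ρ : ℂ) • X) 0 ((coeffBeta ρ : ℂ) • X)

theorem inner_columnBlock (ρ : ℝ) (X : H →L[ℂ] H) (z : WithLp 2 (H × H)) :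
    ⟪columnBlock ρ X z, z⟫_ℂ =
      (coeffAlpha ρ : ℂ) * ⟪X z.snd, z.fst⟫_ℂ + (coeffBeta ρ : ℂ) * ⟪X z.snd, z.snd⟫_ℂ := by
  rw [WithLp.prod_inner_apply]
  change ⟪(columnBlock ρ X z).fst, z.fst⟫_ℂ + ⟪(columnBlock ρ X z).snd, z.snd⟫_ℂ = _
  simp [columnBlock, blockOp_fst, blockOp_snd]

variable [CompleteSpace H]

theorem norm_inner_columnBlock_le_rhoRadius {ρ : ℝ} (hρ : ρ ∈ Set.Ioc (0 : ℝ) 2) (X : H →L[ℂ] H)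
    {z : WithLp 2 (H × H)} (hz : ‖z‖ = 1) : ‖⟪columnBlock ρ X z, z⟫_ℂ‖ ≤ rhoRadius ρ X := by
  -- Nonemptiness matters: the real `sInf` of the empty set is 0.
  refine le_csInf (rhoRadius_set_nonempty hρ.1 X) ?_
  rintro t ⟨ht, hX⟩
  have h1 := hX.norm_form_le hρ z.fst z.snd
  rw [← WithLp.prod_norm_sq_eq_of_L2, hz, one_pow, smul_apply, inner_smul_left, inner_smul_left,
    mul_left_comm, mul_left_comm (coeffBeta ρ : ℂ), ← mul_add, ← inner_columnBlock, norm_mul,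
    Complex.conj_ofReal, Complex.norm_real, Real.norm_of_nonneg (inv_nonneg.2 ht.le),
    inv_mul_le_one₀ ht] at h1
  exact h1

theorem adjoint_columnBlock (ρ : ℝ) (X : H →L[ℂ] H) :
    (columnBlock ρ X).adjoint =
      blockOp 0 0 ((coeffAlpha ρ : ℂ) • X.adjoint) ((coeffBeta ρ : ℂ) • X.adjoint) := by
  symm
  rw [ContinuousLinearMap.eq_adjoint_iff]
  intro z w
  rw [WithLp.prod_inner_apply, WithLp.prod_inner_apply]
  change ⟪WithLp.fst _, w.fst⟫_ℂ + ⟪WithLp.snd _, w.snd⟫_ℂ =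
    ⟪z.fst, (columnBlock ρ X w).fst⟫_ℂ + ⟪z.snd, (columnBlock ρ X w).snd⟫_ℂ
  rw [columnBlock, blockOp_fst, blockOp_snd, blockOp_fst, blockOp_snd]
  simp [ContinuousLinearMap.adjoint_inner_left]

theorem delta_eq_numRadius (ρ ν : ℝ) (X : H →L[ℂ] H) :
    Delta ρ ν X = numRadius
      (columnBlock ρ X + ((1 - 2 * ν : ℝ) : ℂ) • (columnBlock ρ X).adjoint) := by
  rw [Delta, adjoint_columnBlock]
  congr 1
  ext z
  refine withLp_prod_ext ?_ ?_
  · simp only [columnBlock, add_apply, smul_apply, WithLp.add_fst, WithLp.smul_fst, blockOp_fst]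
    simp
  · simp only [columnBlock, add_apply, smul_apply, WithLp.add_snd, WithLp.smul_snd, blockOp_snd]
    push_cast
    change _ = 0 + _ + _
    module

theorem blockOp_eq_mul_adjoint_add (ρ : ℝ) (X : H →L[ℂ] H) :
    blockOp (((coeffAlpha ρ ^ 2 : ℝ) : ℂ) • CFC.abs X.adjoint ^ 2)
      (((coeffAlpha ρ * coeffBeta ρ : ℝ) : ℂ) • CFC.abs X.adjoint ^ 2)
      (((coeffAlpha ρ * coeffBeta ρ : ℝ) : ℂ) • CFC.abs X.adjoint ^ 2)
      (((coeffAlpha ρ ^ 2 + coeffBeta ρ ^ 2 : ℝ) : ℂ) • CFC.abs X ^ 2 +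
        ((coeffBeta ρ ^ 2 : ℝ) : ℂ) • CFC.abs X.adjoint ^ 2) =
    columnBlock ρ X * (columnBlock ρ X).adjoint +
      (columnBlock ρ X).adjoint * columnBlock ρ X := by
  rw [CFC.abs_sq, CFC.abs_sq, ContinuousLinearMap.star_eq_adjoint,
    ContinuousLinearMap.star_eq_adjoint, ContinuousLinearMap.adjoint_adjoint, adjoint_columnBlock]
  ext z
  refine withLp_prod_ext ?_ ?_
  · simp only [columnBlock, add_apply, mul_apply_eq_comp, smul_apply, WithLp.add_fst, blockOp_fst,
      blockOp_snd, zero_apply, map_add, map_smul, map_zero]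
    push_cast
    module
  · simp only [columnBlock, add_apply, mul_apply_eq_comp, smul_apply, WithLp.add_snd, blockOp_fst,
      blockOp_snd, zero_apply, map_add, map_smul, map_zero]
    push_cast
    module

end OperatorRadius

namespace OperatorRadius

/-! ### Numerical radius of N + kN* -/

variable {E : Type u} [NormedAddCommGroup E] [InnerProductSpace ℂ E] [CompleteSpace E]

/-- By Cauchy–Schwarz |⟨Nz, z⟩| is at most both ‖Nz‖ and ‖N*z‖; average the two squares. -/
theorem norm_inner_sq_le (N : E →L[ℂ] E) {z : E} (hz : ‖z‖ = 1) :
    ‖⟪N z, z⟫_ℂ‖ ^ 2 ≤ ‖N * N.adjoint + N.adjoint * N‖ / 2 := by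
  have h1 : ‖⟪N z, z⟫_ℂ‖ ≤ ‖N z‖ := by simpa [hz] using norm_inner_le_norm (𝕜 := ℂ) (N z) z
  have h2 : ‖⟪N z, z⟫_ℂ‖ ≤ ‖N.adjoint z‖ := by
    rw [← ContinuousLinearMap.adjoint_inner_right]
    simpa [hz] using norm_inner_le_norm (𝕜 := ℂ) z (N.adjoint z)
  have h3 : (⟪(N * N.adjoint + N.adjoint * N) z, z⟫_ℂ).re = ‖N.adjoint z‖ ^ 2 + ‖N z‖ ^ 2 := by
    rw [add_apply, inner_add_left, mul_apply_eq_comp, mul_apply_eq_comp,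
      ← ContinuousLinearMap.adjoint_inner_right N (N.adjoint z) z,
      ContinuousLinearMap.adjoint_inner_left N z (N z), Complex.add_re]
    exact congrArg₂ _ (inner_self_eq_norm_sq (𝕜 := ℂ) _) (inner_self_eq_norm_sq (𝕜 := ℂ) _)
  have h4 : (⟪(N * N.adjoint + N.adjoint * N) z, z⟫_ℂ).re ≤ ‖N * N.adjoint + N.adjoint * N‖ := by
    refine (Complex.re_le_norm _).trans ((norm_inner_le_norm (𝕜 := ℂ) _ _).trans ?_)
    rw [hz, mul_one]
    simpa [hz] using (N * N.adjoint + N.adjoint * N).le_opNorm z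
  have h5 := pow_le_pow_left₀ (norm_nonneg _) h1 2
  have h6 := pow_le_pow_left₀ (norm_nonneg _) h2 2
  linarith

theorem numRadius_add_smul_adjoint_sq_le (N : E →L[ℂ] E) (k : ℝ) {w : ℝ}
    (hw : ∀ z : E, ‖z‖ = 1 → ‖⟪N z, z⟫_ℂ‖ ≤ w) :
    numRadius (N + (k : ℂ) • N.adjoint) ^ 2 ≤
      k ^ 2 * w ^ 2 + (2 * |k| + 1) / 2 * ‖N * N.adjoint + N.adjoint * N‖ := by
  have h0 : 0 ≤ numRadius (N + (k : ℂ) • N.adjoint) :=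
    Real.sSup_nonneg (by rintro _ ⟨z, -, rfl⟩; exact norm_nonneg _)
  -- Nonnegativity of the bound covers E = 0, where there are no unit vectors and `sSup` is 0.
  refine (Real.le_sqrt h0 (by positivity)).1 (Real.sSup_le ?_ (Real.sqrt_nonneg _))
  rintro _ ⟨z, hz, rfl⟩
  refine Real.le_sqrt_of_sq_le ?_
  have h1 : ‖⟪(N + (k : ℂ) • N.adjoint) z, z⟫_ℂ‖ ≤ (1 + |k|) * ‖⟪N z, z⟫_ℂ‖ := by
    rw [add_apply, smul_apply, inner_add_left, inner_smul_left,
      ContinuousLinearMap.adjoint_inner_left, ← inner_conj_symm z (N z)]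
    refine (norm_add_le _ _).trans_eq ?_
    rw [norm_mul, RCLike.norm_conj, RCLike.norm_conj, Complex.norm_real, Real.norm_eq_abs]
    ring
  have h2 := pow_le_pow_left₀ (norm_nonneg _) h1 2
  have h3 := mul_le_mul_of_nonneg_left (norm_inner_sq_le N hz)
    (show 0 ≤ 2 * |k| + 1 by positivity)
  have h4 := mul_le_mul_of_nonneg_left (pow_le_pow_left₀ (norm_nonneg _) (hw z hz) 2) (sq_nonneg k)
  have h5 : (1 + |k|) ^ 2 = k ^ 2 + (2 * |k| + 1) := by rw [← sq_abs k]; ring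
  rw [mul_pow, h5] at h2
  linarith

end OperatorRadius

theorem corollary2p15 {H : Type u} [NormedAddCommGroup H] [InnerProductSpace ℂ H]
    [CompleteSpace H] (ρ ν : ℝ) (hρ : ρ ∈ Set.Ioc (0 : ℝ) 2) (hν : ν ∈ Set.Icc (0 : ℝ) 1)
    (X A B C : H →L[ℂ] H)
    (hA : A = ((OperatorRadius.coeffAlpha ρ ^ 2 : ℝ) : ℂ) • CFC.abs X.adjoint ^ 2)
    (hB : B = ((OperatorRadius.coeffAlpha ρ * OperatorRadius.coeffBeta ρ : ℝ) : ℂ) •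
      CFC.abs X.adjoint ^ 2)
    (hC : C = ((OperatorRadius.coeffAlpha ρ ^ 2 + OperatorRadius.coeffBeta ρ ^ 2 : ℝ) : ℂ) •
        CFC.abs X ^ 2 +
      ((OperatorRadius.coeffBeta ρ ^ 2 : ℝ) : ℂ) • CFC.abs X.adjoint ^ 2) :
    OperatorRadius.Delta ρ ν X ^ 2 ≤
      (1 - 2 * ν) ^ 2 * OperatorRadius.rhoRadius ρ X ^ 2 +
        (2 * |1 - 2 * ν| + 1) / 2 * ‖OperatorRadius.blockOp A B B C‖ := by
  rw [hA, hB, hC, OperatorRadius.blockOp_eq_mul_adjoint_add, OperatorRadius.delta_eq_numRadius]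
  exact OperatorRadius.numRadius_add_smul_adjoint_sq_le _ _ fun z hz =>
    OperatorRadius.norm_inner_columnBlock_le_rhoRadius hρ X hz
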